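/- For $p\in[0,1]$ and an $\mathbb N_0$-valued random variable $X$, the $p$-thinning of $X$ is $p\odot X=\sum_{i=1}^{X}\varepsilon_i$, where the $\varepsilon_i$ are $\mathrm{Bin}(1,p)$-distributed and independent of each other and of $X$. When the components of a random vector $(X_1,\ldots,X_s)$ are thinned, $p_r\odot X_r=\sum_{i=1}^{X_r}\varepsilon_{r,i}$, all variables $\varepsilon_{r,i}\sim\mathrm{Bin}(1,p_r)$, $r=1,\ldots,s$, $i\in\mathbb N$, are independent of each other and the whole family is independent of the vector $(X_1,\ldots,X_s)$. Let $\mathbf Y=(Y_1,\ldots,Y_s)$ be a random vector with a.s. non-negative components and distribution $F_{\mathbf Y}$. A random vector $\mathbf Z=(Z_1,\ldots,Z_s)$ with values in $\mathbb N_0^s$ has the multivariate mixed Poisson distribution with mixing distribution of $\mathbf Y$ if, for all $k_1,\ldots,k_s\in\mathbb N_0$, $$\mathbb P\{Z_1=k_1,\ldots,Z_s=k_s\}=\int_{[0,+\infty)^s}\prod_{r=1}^s\frac{e^{-y_r}y_r^{k_r}}{k_r!}\,F_{\mathbf Y}(dy_1,\ldots,dy_s).$$ **Theorem.** Let $\mathbf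 X^{(n)}=(X_1^{(n)},\ldots,X_s^{(n)})$, $n\in\mathbb N$, be a sequence of random vectors with $\mathbb N_0$-valued components (for different $n$ they may be defined on different probability spaces), and let $(p_1^{(n)},\ldots,p_s^{(n)})\in[0,1]^s$, $n\in\mathbb N$, be a non-random sequence with $\lim_{n\to\infty}p_r^{(n)}=0$ for $r=1,\ldots,s$. Assume that $$\bigl(p_1^{(n)}\odot X_1^{(n)},\ldots,p_s^{(n)}\odot X_s^{(n)}\bigr)\xrightarrow{d}(Z_1,\ldots,Z_s)\quad\text{as }n\to\infty,$$ where $(Z_1,\ldots,Z_s)$ has the multivariate mixed Poisson distribution with mixing distribution of $\mathbf Y=(Y_1,\ldots,Y_s)$. Suppose additionally that $$\sup_{n\in\mathbb N}p_r^{(n)}\,\mathbb E X_r^{(n)}<\infty,\quad r=1,\ldots,s$$ (with the convention $0\cdot\infty=0$). Then $$\bigl(p_1^{(n)}X_1^{(n)},\ldots,p_s^{(n)}X_s^{(n)}\bigr)\xrightarrow{d}(Y_1,\ldots,Y_s)\quad\text{as }n\to\infty.$$ -/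

import Mathlib

open MeasureTheory ProbabilityTheory Filter
open scoped Topology unitInterval

noncomputable section

/-- The variables `ε r i` (`r < s`, `i ∈ ℕ`) can be used to thin the `ℕ`-valued random vector
`X = (X_1, …, X_s)` with retention probabilities `p = (p_1, …, p_s)`: each `ε r i` has the law
`Bin(1, p_r)`, all the `ε r i` are mutually independent, and the whole family is independent of
the random vector `X`. -/
structure IsThinningFamily {Ω : Type*} [MeasurableSpace Ω] {s : ℕ} (μ : Measure Ω)
    (p : Fin s → I) (X : Ω → Fin s → ℕ) (ε : Fin s → ℕ → Ω → ℕ) : Prop where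
  law : ∀ r i, HasLaw (ε r i) (ProbabilityTheory.binomial 1 (p r)) μ
  indep_family : iIndepFun (fun (j : Fin s × ℕ) ω => ε j.1 j.2 ω) μ
  indep_vector : IndepFun X (fun ω (j : Fin s × ℕ) => ε j.1 j.2 ω) μ

/-- The thinned vector `(p_1 ⊙ X_1, …, p_s ⊙ X_s)`, where `p_r ⊙ X_r` is the sum of the first
`X_r` of the variables `ε r 0, ε r 1, …`. -/
def thinned {Ω : Type*} {s : ℕ} (X : Ω → Fin s → ℕ) (ε : Fin s → ℕ → Ω → ℕ) :
    Ω → Fin s → ℕ :=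
  fun ω r => ∑ i ∈ Finset.range (X ω r), ε r i ω

/-- The `ℕ`-valued random vector `Z` has the multivariate mixed Poisson distribution with mixing
distribution `Q`, a probability law on `ℝ^s` (carried by `[0, ∞)^s`):
`P(Z_1 = k_1, …, Z_s = k_s) = ∫_{[0, ∞)^s} ∏_r e^{-y_r} y_r^{k_r} / k_r! Q(dy)`. -/
def IsMixedPoisson {Ω : Type*} [MeasurableSpace Ω] {s : ℕ} (ν : Measure Ω)
    (Z : Ω → Fin s → ℕ) (Q : Measure (Fin s → ℝ)) : Prop :=
  ∀ k : Fin s → ℕ, ν.real {ω | Z ω = k} =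
    ∫ y in {y : Fin s → ℝ | ∀ r, 0 ≤ y r},
      ∏ r, (Real.exp (-(y r)) * y r ^ k r / (Nat.factorial (k r) : ℝ)) ∂Q

end

/-!
If `p ⊙ X` thins `X` by `p`, its probability generating function at `1 - t` is that of `X` at
`1 - p t`, and `|(1 - p t) ^ k - exp (-p t k)| ≤ p t` uniformly in `k`. As `p → 0`, the generating
function of `p ⊙ X` at `1 - t` is therefore asymptotically the Laplace transform of `p X` at `t`,
whatever the law of `X`. On the other hand, the generating function at `1 - t` of a mixed Poisson
vector is the Laplace transform at `t` of its mixing law. So the Laplace transforms of `p X`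
converge to that of `Y` on the cube `[0, 1]^s`. This is enough for convergence in distribution:
continuity of the limit at `0` gives tightness, and since Laplace transforms are real-analytic along
rays, a law is determined by the germ of its transform at `0`.
-/

open scoped NNReal BoundedContinuousFunction

section Laplace

variable {ι : Type*} [Fintype ι]

/-- The function `y ↦ exp (-⟨t, y⟩)` on the orthant `[0, ∞)^ι`, where it is bounded; its integral
is the Laplace transform at `t`. -/
noncomputable def laplaceKernel (t : ι → ℝ≥0) : (ι → ℝ≥0) →ᵇ ℝ :=
  .ofNormedAddCommGroup (fun y => Real.exp (-(t ⬝ᵥ y : ℝ≥0)))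
    (Real.continuous_exp.comp <|
      (NNReal.continuous_coe.comp (continuous_const.dotProduct continuous_id)).neg)
    1 fun y => by simp

@[simp]
lemma laplaceKernel_apply (t y : ι → ℝ≥0) :
    laplaceKernel t y = Real.exp (-(t ⬝ᵥ y : ℝ≥0)) := rfl

@[simp]
lemma laplaceKernel_zero : laplaceKernel (0 : ι → ℝ≥0) = 1 := by
  ext y
  simp

lemma laplaceKernel_add (t u : ι → ℝ≥0) :
    laplaceKernel (t + u) = laplaceKernel t * laplaceKernel u := by
  ext y
  simp [add_dotProduct, Real.exp_add, add_comm]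

/-- The Laplace transform of a measure on the orthant `[0, ∞)^ι`. -/
noncomputable def laplaceTransform (μ : Measure (ι → ℝ≥0)) (t : ι → ℝ≥0) : ℝ :=
  ∫ y, laplaceKernel t y ∂μ

lemma laplaceTransform_zero (μ : Measure (ι → ℝ≥0)) [IsProbabilityMeasure μ] :
    laplaceTransform μ 0 = 1 := by
  simp [laplaceTransform]

lemma continuous_laplaceTransform (μ : Measure (ι → ℝ≥0)) [IsFiniteMeasure μ] :
    Continuous (laplaceTransform μ) := by
  refine continuous_of_dominated (bound := fun _ => 1)
    (fun t => (laplaceKernel t).continuous.aestronglyMeasurable) (fun t => .of_forall fun y => ?_)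
    (integrable_const 1) (.of_forall fun y => ?_)
  · simp
  · simp only [laplaceKernel_apply]
    exact Real.continuous_exp.comp
      (NNReal.continuous_coe.comp (continuous_id.dotProduct continuous_const)).neg

theorem ext_of_forall_mem_submonoid_integral_eq {E : Type*} [TopologicalSpace E] [PolishSpace E]
    [MeasurableSpace E] [BorelSpace E] {μ ν : Measure E} [IsFiniteMeasure μ] [IsFiniteMeasure ν]
    (M : Submonoid (E →ᵇ ℝ)) (hsep : ∀ x y, x ≠ y → ∃ g ∈ M, g x ≠ g y)
    (h : ∀ g ∈ M, ∫ x, g x ∂μ = ∫ x, g x ∂ν) : μ = ν := by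
  let A : StarSubalgebra ℝ (E →ᵇ ℝ) :=
    { Algebra.adjoin ℝ (M : Set (E →ᵇ ℝ)) with
      star_mem' := fun {g} hg => by rwa [show star g = g from by ext; simp] }
  refine ext_of_forall_mem_subalgebra_integral_eq_of_polish (𝕜 := ℝ) (A := A)
    (fun x y hxy => ?_) fun g hg => ?_
  · obtain ⟨g, hg, hne⟩ := hsep x y hxy
    exact ⟨g, ⟨g, ⟨g, Algebra.subset_adjoin hg, rfl⟩, rfl⟩, hne⟩
  · have hspan : g ∈ Submodule.span ℝ (M : Set (E →ᵇ ℝ)) := by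
      rw [← M.closure_eq, ← Algebra.adjoin_eq_span]
      exact hg
    clear hg
    induction hspan using Submodule.span_induction with
    | mem g hg => exact h g hg
    | zero => simp
    | add f g _ _ hf hg =>
      simp only [BoundedContinuousFunction.coe_add, Pi.add_apply]
      rw [integral_add (f.integrable μ) (g.integrable μ),
        integral_add (f.integrable ν) (g.integrable ν), hf, hg]
    | smul c g _ hg =>
      simp only [BoundedContinuousFunction.coe_smul, integral_smul, hg]

theorem ext_of_laplaceTransform_eq {μ ν : Measure (ι → ℝ≥0)} [IsFiniteMeasure μ]
    [IsFiniteMeasure ν] (h : laplaceTransform μ = laplaceTransform ν) : μ = ν := by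
  classical
  let M : Submonoid ((ι → ℝ≥0) →ᵇ ℝ) :=
    { carrier := Set.range laplaceKernel
      one_mem' := ⟨0, laplaceKernel_zero⟩
      mul_mem' := by
        rintro _ _ ⟨t, rfl⟩ ⟨u, rfl⟩
        exact ⟨t + u, laplaceKernel_add t u⟩ }
  refine ext_of_forall_mem_submonoid_integral_eq M (fun x y hxy => ?_) ?_
  · obtain ⟨r, hr⟩ := Function.ne_iff.1 hxy
    exact ⟨_, ⟨Pi.single r 1, rfl⟩, by simpa using hr⟩
  · rintro _ ⟨t, rfl⟩
    exact congrFun h t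

lemma analyticOnNhd_laplaceTransform_smul (μ : Measure (ι → ℝ≥0)) [IsFiniteMeasure μ]
    (t : ι → ℝ≥0) :
    AnalyticOnNhd ℝ (fun θ : ℝ => laplaceTransform μ (θ.toNNReal • t)) (Set.Ioi 0) := by
  set f : (ι → ℝ≥0) → ℝ := fun y => -(t ⬝ᵥ y : ℝ≥0)
  have hexp {θ : ℝ} (hθ : 0 < θ) (y : ι → ℝ≥0) :
      laplaceKernel (θ.toNNReal • t) y = Real.exp (θ * f y) := by
    simp [f, hθ.le]
  have hint : Set.Ioi 0 ⊆ interior (integrableExpSet f μ) :=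
    interior_maximal (fun θ hθ => ((laplaceKernel (θ.toNNReal • t)).integrable μ).congr <|
      .of_forall (hexp hθ)) isOpen_Ioi
  refine (analyticOnNhd_mgf.mono hint).congr isOpen_Ioi fun θ hθ => ?_
  simp only [laplaceTransform, hexp hθ, mgf]

theorem ext_of_laplaceTransform_eventuallyEq {μ ν : Measure (ι → ℝ≥0)} [IsFiniteMeasure μ]
    [IsFiniteMeasure ν] (h : laplaceTransform μ =ᶠ[𝓝 0] laplaceTransform ν) : μ = ν := by
  refine ext_of_laplaceTransform_eq (funext fun t => ?_)
  have hray : Tendsto (fun θ : ℝ => θ.toNNReal • t) (𝓝 0) (𝓝 0) := by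
    have : Continuous fun θ : ℝ => θ.toNNReal • t := by fun_prop
    simpa using this.tendsto 0
  set Lμ : ℝ → ℝ := fun θ => laplaceTransform μ (θ.toNNReal • t)
  set Lν : ℝ → ℝ := fun θ => laplaceTransform ν (θ.toNNReal • t)
  have hnear : ∀ᶠ θ in 𝓝 0, Lμ =ᶠ[𝓝 θ] Lν := (hray.eventually h).eventually_nhds
  obtain ⟨θ, hθ, hθ0⟩ : ∃ θ, Lμ =ᶠ[𝓝 θ] Lν ∧ 0 < θ :=
    ((hnear.filter_mono nhdsWithin_le_nhds).and (self_mem_nhdsWithin (s := Set.Ioi 0))).exists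
  have hone : Lμ 1 = Lν 1 :=
    (analyticOnNhd_laplaceTransform_smul μ t).eqOn_of_preconnected_of_eventuallyEq
      (analyticOnNhd_laplaceTransform_smul ν t) isPreconnected_Ioi hθ0 hθ (Set.mem_Ioi.2 one_pos)
  simpa [Lμ, Lν] using hone

lemma isTightMeasureSet_range_of_eventually {E : Type*} [TopologicalSpace E] [PolishSpace E]
    [MeasurableSpace E] [BorelSpace E] {μ : ℕ → Measure E} [∀ n, IsFiniteMeasure (μ n)]
    (h : ∀ ε : ℝ, 0 < ε → ∃ K, IsCompact K ∧ ∀ᶠ n in atTop, (μ n).real Kᶜ ≤ ε) :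
    IsTightMeasureSet (Set.range μ) := by
  rw [isTightMeasureSet_iff_exists_isCompact_measure_compl_le]
  intro ε hε
  obtain ⟨δ, hδ, hδε⟩ := ENNReal.lt_iff_exists_nnreal_btwn.1 hε
  obtain ⟨K, hK, hKμ⟩ := h δ (by simpa using hδ)
  obtain ⟨N, hN⟩ := eventually_atTop.1 hKμ
  choose L hL hLμ using fun n => isTightMeasureSet_iff_exists_isCompact_measure_compl_le.1
    (isTightMeasureSet_singleton (μ := μ n)) ε hε
  refine ⟨K ∪ ⋃ n ∈ Finset.range N, L n,
    hK.union ((Finset.range N).isCompact_biUnion fun n _ => hL n), ?_⟩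
  rintro _ ⟨n, rfl⟩
  rcases lt_or_ge n N with hn | hn
  · refine (measure_mono (Set.compl_subset_compl.2 ?_)).trans (hLμ n (μ n) rfl)
    exact (Set.subset_biUnion_of_mem (u := L) (Finset.mem_coe.2 (Finset.mem_range.2 hn))).trans
      Set.subset_union_right
  · calc μ n (K ∪ ⋃ n ∈ Finset.range N, L n)ᶜ ≤ μ n Kᶜ :=
          measure_mono (Set.compl_subset_compl.2 Set.subset_union_left)
      _ = ENNReal.ofReal ((μ n).real Kᶜ) := (ofReal_measureReal).symm
      _ ≤ ENNReal.ofReal δ := ENNReal.ofReal_le_ofReal (hN n hn)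
      _ ≤ ε := by simpa using hδε.le

lemma mul_measureReal_one_le_dotProduct_le (μ : Measure (ι → ℝ≥0)) [IsProbabilityMeasure μ]
    (t : ι → ℝ≥0) :
    (1 - Real.exp (-1)) * μ.real {y | 1 ≤ t ⬝ᵥ y} ≤ 1 - laplaceTransform μ t := by
  have hint : Integrable (fun y => 1 - laplaceKernel t y) μ :=
    (integrable_const 1).sub ((laplaceKernel t).integrable μ)
  have hset : {y | 1 ≤ t ⬝ᵥ y} = {y | 1 - Real.exp (-1) ≤ 1 - laplaceKernel t y} := by
    ext y
    simp only [Set.mem_ofPred_eq, laplaceKernel_apply, sub_le_sub_iff_left, Real.exp_le_exp,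
      neg_le_neg_iff, NNReal.one_le_coe]
  calc (1 - Real.exp (-1)) * μ.real {y | 1 ≤ t ⬝ᵥ y} ≤ ∫ y, (1 - laplaceKernel t y) ∂μ :=
        hset ▸ mul_meas_ge_le_integral_of_nonneg (.of_forall fun y => by simp) hint _
    _ = 1 - laplaceTransform μ t := by
        rw [integral_sub (integrable_const 1) ((laplaceKernel t).integrable μ)]
        simp [laplaceTransform]

lemma isCompact_setOf_dotProduct_le {t : ι → ℝ≥0} (ht : ∀ r, 0 < t r) (b : ℝ≥0) :
    IsCompact {y | t ⬝ᵥ y ≤ b} := by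
  refine (isCompact_Icc (a := 0) (b := fun r => b / t r)).of_isClosed_subset
    (isClosed_le (continuous_const.dotProduct continuous_id) continuous_const)
    fun y hy => ⟨zero_le, fun r => ?_⟩
  rw [le_div_iff₀' (ht r)]
  exact (Finset.single_le_sum (f := fun r => t r * y r) (fun _ _ => zero_le)
    (Finset.mem_univ r)).trans hy

theorem isTightMeasureSet_range_of_tendsto_laplaceTransform {μ : ℕ → Measure (ι → ℝ≥0)}
    [∀ n, IsProbabilityMeasure (μ n)] {μ₀ : Measure (ι → ℝ≥0)} [IsProbabilityMeasure μ₀]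
    (h : ∀ᶠ t in 𝓝 0,
      Tendsto (fun n => laplaceTransform (μ n) t) atTop (𝓝 (laplaceTransform μ₀ t))) :
    IsTightMeasureSet (Set.range μ) := by
  refine isTightMeasureSet_range_of_eventually fun ε hε => ?_
  have hc : 0 < 1 - Real.exp (-1) := by simp
  have hnear : ∀ᶠ t in 𝓝 0, 1 - (1 - Real.exp (-1)) * ε < laplaceTransform μ₀ t :=
    (continuous_laplaceTransform μ₀).continuousAt.eventually_const_lt <| by
      rw [laplaceTransform_zero]
      linarith [mul_pos hc hε]
  have hdiag : Tendsto (fun (c : ℝ≥0) (_ : ι) => c) (𝓝[>] 0) (𝓝 0) :=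
    (tendsto_pi_nhds.2 fun _ => tendsto_id).mono_left nhdsWithin_le_nhds
  obtain ⟨c, ⟨hlim, hlt⟩, hc0⟩ :=
    ((hdiag.eventually (h.and hnear)).and (self_mem_nhdsWithin (s := Set.Ioi 0))).exists
  refine ⟨_, isCompact_setOf_dotProduct_le (fun _ => hc0) 1, ?_⟩
  filter_upwards [hlim.eventually_const_lt hlt] with n hn
  refine le_of_mul_le_mul_left ?_ hc
  calc (1 - Real.exp (-1)) * (μ n).real {y | (fun _ => c) ⬝ᵥ y ≤ 1}ᶜ
      ≤ (1 - Real.exp (-1)) * (μ n).real {y | 1 ≤ (fun _ => c) ⬝ᵥ y} :=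
        mul_le_mul_of_nonneg_left (measureReal_mono fun y hy => le_of_lt (by simpa using hy)) hc.le
    _ ≤ 1 - laplaceTransform (μ n) fun _ => c := mul_measureReal_one_le_dotProduct_le _ _
    _ ≤ (1 - Real.exp (-1)) * ε := by linarith

theorem tendsto_of_tendsto_laplaceTransform {P : ℕ → ProbabilityMeasure (ι → ℝ≥0)}
    {P₀ : ProbabilityMeasure (ι → ℝ≥0)}
    (h : ∀ᶠ t in 𝓝 0, Tendsto (fun n => laplaceTransform (P n : Measure (ι → ℝ≥0)) t) atTop
      (𝓝 (laplaceTransform (P₀ : Measure (ι → ℝ≥0)) t))) :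
    Tendsto P atTop (𝓝 P₀) := by
  refine (tendsto_iff_ultrafilter _ _ _).2 fun U hU => ?_
  have hcompact : IsCompact (closure (Set.range P)) := by
    refine isCompact_closure_of_isTightMeasureSet ?_
    simpa [Set.range] using isTightMeasureSet_range_of_tendsto_laplaceTransform h
  obtain ⟨ρ, -, hρ⟩ := hcompact.ultrafilter_le_nhds (U.map P)
    (.trans (by simp) (monotone_principal subset_closure))
  replace hρ : Tendsto P U (𝓝 ρ) := hρ
  suffices (ρ : Measure (ι → ℝ≥0)) = P₀ by rwa [Subtype.ext this] at hρ
  refine ext_of_laplaceTransform_eventuallyEq ?_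
  filter_upwards [h] with t ht
  exact tendsto_nhds_unique
    (ProbabilityMeasure.tendsto_iff_forall_integral_tendsto.1 hρ (laplaceKernel t)) (ht.comp hU)

theorem tendstoInDistribution_of_tendsto_laplaceTransform {Ω : ℕ → Type*}
    [∀ n, MeasurableSpace (Ω n)] {μ : ∀ n, Measure (Ω n)} [∀ n, IsProbabilityMeasure (μ n)]
    {Ω' : Type*} [MeasurableSpace Ω'] {μ' : Measure Ω'} [IsProbabilityMeasure μ']
    {V : ∀ n, Ω n → ι → ℝ≥0} {W : Ω' → ι → ℝ≥0} (hV : ∀ n, AEMeasurable (V n) (μ n))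
    (hW : AEMeasurable W μ')
    (h : ∀ᶠ t in 𝓝 0, Tendsto (fun n => laplaceTransform ((μ n).map (V n)) t) atTop
      (𝓝 (laplaceTransform (μ'.map W) t))) :
    TendstoInDistribution V atTop W μ μ' :=
  ⟨hV, hW, tendsto_of_tendsto_laplaceTransform h⟩

end Laplace

section GeneratingFunction

variable {ι : Type*} [Fintype ι]

lemma abs_prod_one_sub_pow_le_one (t : ι → I) (k : ι → ℕ) : |∏ r, (1 - t r : ℝ) ^ k r| ≤ 1 := by
  rw [Finset.abs_prod]
  refine Finset.prod_le_one (fun r _ => abs_nonneg _) fun r _ => ?_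
  rw [abs_pow, abs_of_nonneg (unitInterval.one_minus_nonneg _)]
  exact pow_le_one₀ (unitInterval.one_minus_nonneg _) (unitInterval.one_minus_le_one _)

/-- The function `k ↦ ∏ r, (1 - t r) ^ k r` on `ℕ^ι`, for `t` in the cube `[0, 1]^ι`, where it is
bounded; its integral is the probability generating function at `1 - t`. -/
noncomputable def altPGFKernel (t : ι → I) : (ι → ℕ) →ᵇ ℝ :=
  .ofNormedAddCommGroup (fun k => ∏ r, (1 - t r : ℝ) ^ k r) (by fun_prop) 1
    (abs_prod_one_sub_pow_le_one t)

@[simp]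
lemma altPGFKernel_apply (t : ι → I) (k : ι → ℕ) :
    altPGFKernel t k = ∏ r, (1 - t r : ℝ) ^ k r := rfl

/-- The probability generating function at `1 - t` of a measure on `ℕ^ι`. The variable `t` is used
because thinning acts on it by multiplication. -/
noncomputable def altPGF (ρ : Measure (ι → ℕ)) (t : ι → I) : ℝ :=
  ∫ k, altPGFKernel t k ∂ρ

/-- The product of Poisson laws with parameters `y r`, as a kernel from `[0, ∞)^ι` to `ℕ^ι`. -/
noncomputable def poissonProductKernel : Kernel (ι → ℝ≥0) (ι → ℕ) where
  toFun y := Measure.pi fun r => poissonMeasure (y r)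
  measurable' := by
    refine Measure.measurable_of_measurable_coe _ fun s hs => ?_
    simp_rw [← Measure.tsum_indicator_apply_singleton _ s hs]
    refine Measurable.tsum fun k => ?_
    by_cases hk : k ∈ s
    · simp only [Set.indicator_of_mem hk, Measure.pi_singleton, poissonMeasure_singleton]
      fun_prop
    · simp only [Set.indicator_of_notMem hk, measurable_const]

lemma poissonProductKernel_apply (y : ι → ℝ≥0) :
    poissonProductKernel y = Measure.pi fun r => poissonMeasure (y r) := rfl

instance : IsMarkovKernel (poissonProductKernel (ι := ι)) :=
  ⟨fun y => by rw [poissonProductKernel_apply]; infer_instance⟩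

lemma poissonProductKernel_apply_singleton (y : ι → ℝ≥0) (k : ι → ℕ) :
    poissonProductKernel y {k} =
      ENNReal.ofReal (∏ r, (Real.exp (-(y r)) * y r ^ k r / (Nat.factorial (k r) : ℝ))) := by
  rw [poissonProductKernel_apply, Measure.pi_singleton, ENNReal.ofReal_prod_of_nonneg fun r _ => by
    positivity]
  simp only [poissonMeasure_singleton]

lemma integral_pow_poissonMeasure (y : ℝ≥0) (z : ℝ) :
    ∫ k, z ^ k ∂poissonMeasure y = Real.exp (-((1 - z) * y)) := by
  rw [integral_poissonMeasure]
  have hexp := ((NormedSpace.expSeries_div_hasSum_exp (y * z : ℝ)).mul_left (Real.exp (-y))).tsum_eq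
  rw [← Real.exp_eq_exp_ℝ, ← Real.exp_add] at hexp
  calc ∑' k : ℕ, (Real.exp (-y) * y ^ k / k.factorial) • z ^ k
      = ∑' k : ℕ, Real.exp (-y) * ((y * z) ^ k / k.factorial) := by
        congr 1 with k
        rw [smul_eq_mul, mul_pow]
        ring
    _ = Real.exp (-((1 - z) * y)) := by rw [hexp]; ring_nf

lemma altPGF_poissonProductKernel (y : ι → ℝ≥0) (t : ι → I) :
    altPGF (poissonProductKernel y) t = laplaceKernel (unitInterval.toNNReal ∘ t) y := by
  simp only [altPGF, poissonProductKernel_apply, altPGFKernel_apply]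
  rw [integral_fintype_prod_eq_prod (f := fun r (k : ℕ) => (1 - t r : ℝ) ^ k)]
  simp only [integral_pow_poissonMeasure, sub_sub_cancel, ← Real.exp_sum, Finset.sum_neg_distrib]
  simp [dotProduct]

lemma altPGF_comp_poissonProductKernel (Q : Measure (ι → ℝ≥0)) [IsFiniteMeasure Q]
    (t : ι → I) :
    altPGF (poissonProductKernel ∘ₘ Q) t = laplaceTransform Q (unitInterval.toNNReal ∘ t) := by
  rw [altPGF, ← Measure.snd_compProd, Measure.snd, integral_map measurable_snd.aemeasurable
    (altPGFKernel t).continuous.aestronglyMeasurable, Measure.integral_compProd]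
  · exact integral_congr_ae (.of_forall fun y => altPGF_poissonProductKernel y t)
  · exact .of_bound ((altPGFKernel t).continuous.stronglyMeasurable.comp_measurable
      measurable_snd).aestronglyMeasurable _
      (.of_forall fun x => (altPGFKernel t).norm_coe_le_norm _)

end GeneratingFunction

lemma abs_prod_sub_prod_le {ι : Type*} (s : Finset ι) {a b : ι → ℝ}
    (ha : ∀ i ∈ s, |a i| ≤ 1) (hb : ∀ i ∈ s, |b i| ≤ 1) :
    |∏ i ∈ s, a i - ∏ i ∈ s, b i| ≤ ∑ i ∈ s, |a i - b i| := by
  induction s using Finset.cons_induction with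
  | empty => simp
  | cons i s hi ih =>
    rw [Finset.forall_mem_cons] at ha hb
    have hprod : |∏ j ∈ s, b j| ≤ 1 := by
      rw [Finset.abs_prod]
      exact Finset.prod_le_one (fun _ _ => abs_nonneg _) hb.2
    rw [Finset.prod_cons, Finset.prod_cons, Finset.sum_cons]
    calc |a i * ∏ j ∈ s, a j - b i * ∏ j ∈ s, b j|
        = |(a i - b i) * ∏ j ∈ s, b j + a i * (∏ j ∈ s, a j - ∏ j ∈ s, b j)| := by ring_nf
      _ ≤ |a i - b i| * |∏ j ∈ s, b j| + |a i| * |∏ j ∈ s, a j - ∏ j ∈ s, b j| := by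
          rw [← abs_mul, ← abs_mul]
          exact abs_add_le _ _
      _ ≤ |a i - b i| * 1 + 1 * ∑ j ∈ s, |a j - b j| := by
          gcongr
          · exact ha.1
          · exact ih ha.2 hb.2
      _ = |a i - b i| + ∑ j ∈ s, |a j - b j| := by ring

lemma abs_one_sub_pow_sub_exp_pow_le {u : ℝ} (hu : u ∈ I) (k : ℕ) :
    |(1 - u) ^ k - Real.exp (-u) ^ k| ≤ u := by
  have h0 : 0 ≤ 1 - u := sub_nonneg.2 hu.2
  have hquad : |Real.exp (-u) - (1 - u)| ≤ u ^ 2 := by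
    have h := Real.abs_exp_sub_one_sub_id_le (x := -u)
      (by rw [abs_neg, abs_of_nonneg hu.1]; exact hu.2)
    rw [neg_sq] at h
    convert h using 2
    ring
  induction k with
  | zero => simpa using hu.1
  | succ k ih =>
    have hexp : |Real.exp (-u) ^ k| ≤ 1 := by
      rw [abs_of_nonneg (by positivity)]
      exact pow_le_one₀ (Real.exp_nonneg _) (Real.exp_le_one_iff.2 (neg_nonpos.2 hu.1))
    calc |(1 - u) ^ (k + 1) - Real.exp (-u) ^ (k + 1)|
        = |(1 - u) * ((1 - u) ^ k - Real.exp (-u) ^ k) -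
            Real.exp (-u) ^ k * (Real.exp (-u) - (1 - u))| := by ring_nf
      _ ≤ (1 - u) * |(1 - u) ^ k - Real.exp (-u) ^ k| +
            |Real.exp (-u) ^ k| * |Real.exp (-u) - (1 - u)| := by
          refine (abs_sub _ _).trans_eq ?_
          rw [abs_mul, abs_mul, abs_of_nonneg h0]
      _ ≤ (1 - u) * u + 1 * u ^ 2 := by gcongr
      _ = u := by ring

lemma abs_prod_one_sub_pow_sub_exp_le {ι : Type*} [Fintype ι] (u : ι → I) (k : ι → ℕ) :
    |∏ r, (1 - u r : ℝ) ^ k r - Real.exp (-∑ r, (u r * k r : ℝ))| ≤ ∑ r, (u r : ℝ) := by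
  have hexp : Real.exp (-∑ r, (u r * k r : ℝ)) = ∏ r, Real.exp (-u r) ^ k r := by
    simp only [← Finset.sum_neg_distrib, Real.exp_sum, ← Real.exp_nat_mul, mul_neg, mul_comm]
  rw [hexp]
  refine (abs_prod_sub_prod_le _ (fun r _ => ?_) fun r _ => ?_).trans
    (Finset.sum_le_sum fun r _ => abs_one_sub_pow_sub_exp_pow_le (u r).2 (k r))
  · rw [abs_pow, abs_of_nonneg (unitInterval.one_minus_nonneg _)]
    exact pow_le_one₀ (unitInterval.one_minus_nonneg _) (unitInterval.one_minus_le_one _)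
  · rw [abs_pow, Real.abs_exp]
    exact pow_le_one₀ (Real.exp_nonneg _) (Real.exp_le_one_iff.2 (neg_nonpos.2 (u r).2.1))

lemma eventually_nhds_zero_mem_range_toNNReal_comp {ι : Type*} [Finite ι] :
    ∀ᶠ t : ι → ℝ≥0 in 𝓝 0, ∃ u : ι → I, unitInterval.toNNReal ∘ u = t := by
  have hle : ∀ᶠ t : ι → ℝ≥0 in 𝓝 0, ∀ r, t r ≤ 1 := eventually_all.2 fun r =>
    (continuous_apply r).continuousAt.eventually_le_const (by simp)
  filter_upwards [hle] with t ht
  exact ⟨fun r => ⟨t r, (t r).2, ht r⟩, rfl⟩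

section Rescaling

variable {ι : Type*} [Fintype ι]

/-- The rescaling `(k_r) ↦ (p_r k_r)` from `ℕ^ι` to the orthant `[0, ∞)^ι`. -/
noncomputable def rescale (p : ι → I) (k : ι → ℕ) : ι → ℝ≥0 :=
  fun r => unitInterval.toNNReal (p r) * k r

lemma abs_altPGF_sub_laplaceTransform_map_rescale_le (ρ : Measure (ι → ℕ)) [IsProbabilityMeasure ρ]
    (p t : ι → I) :
    |altPGF ρ (p * t) - laplaceTransform (ρ.map (rescale p)) (unitInterval.toNNReal ∘ t)| ≤
      ∑ r, (p r * t r : ℝ) := by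
  have hmap : laplaceTransform (ρ.map (rescale p)) (unitInterval.toNNReal ∘ t) =
      ∫ k, laplaceKernel (unitInterval.toNNReal ∘ t) (rescale p k) ∂ρ :=
    integral_map (measurable_of_countable _).aemeasurable
      (laplaceKernel _).continuous.aestronglyMeasurable
  have hker (k : ι → ℕ) : laplaceKernel (unitInterval.toNNReal ∘ t) (rescale p k) =
      Real.exp (-∑ r, ((p * t) r * k r : ℝ)) := by
    simp [dotProduct, rescale, mul_assoc, mul_left_comm]
  have hint : Integrable (fun k => laplaceKernel (unitInterval.toNNReal ∘ t) (rescale p k)) ρ :=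
    .of_bound (measurable_of_countable _).aestronglyMeasurable _
      (.of_forall fun k => (laplaceKernel _).norm_coe_le_norm _)
  have hbound (k : ι → ℕ) : ‖altPGFKernel (p * t) k -
      laplaceKernel (unitInterval.toNNReal ∘ t) (rescale p k)‖ ≤ ∑ r, (p r * t r : ℝ) := by
    rw [hker, Real.norm_eq_abs]
    exact abs_prod_one_sub_pow_sub_exp_le (p * t) k
  rw [hmap, altPGF, ← integral_sub ((altPGFKernel _).integrable ρ) hint]
  simpa using norm_integral_le_of_norm_le_const (μ := ρ) (.of_forall hbound)

lemma tendsto_laplaceTransform_map_rescale {ρ : ℕ → Measure (ι → ℕ)}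
    [∀ n, IsProbabilityMeasure (ρ n)] {p : ℕ → ι → I}
    (hp : ∀ r, Tendsto (fun n => (p n r : ℝ)) atTop (𝓝 0)) {t : ι → I} {a : ℝ}
    (h : Tendsto (fun n => altPGF (ρ n) (p n * t)) atTop (𝓝 a)) :
    Tendsto (fun n => laplaceTransform ((ρ n).map (rescale (p n))) (unitInterval.toNNReal ∘ t))
      atTop (𝓝 a) := by
  have hzero : Tendsto (fun n => ∑ r, (p n r * t r : ℝ)) atTop (𝓝 0) := by
    simpa using tendsto_finsetSum Finset.univ fun r _ => (hp r).mul_const (t r : ℝ)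
  refine (tendsto_iff_of_dist ?_).1 h
  exact squeeze_zero (fun _ => dist_nonneg)
    (fun n => abs_altPGF_sub_laplaceTransform_map_rescale_le (ρ n) (p n) t) hzero

theorem tendstoInDistribution_rescale_of_tendsto_altPGF {Ω : ℕ → Type*}
    [∀ n, MeasurableSpace (Ω n)] {μ : ∀ n, Measure (Ω n)} [∀ n, IsProbabilityMeasure (μ n)]
    {Ω' : Type*} [MeasurableSpace Ω'] {μ' : Measure Ω'} [IsProbabilityMeasure μ']
    {X : ∀ n, Ω n → ι → ℕ} {W : Ω' → ι → ℝ≥0} (hX : ∀ n, AEMeasurable (X n) (μ n))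
    (hW : AEMeasurable W μ') {p : ℕ → ι → I}
    (hp : ∀ r, Tendsto (fun n => (p n r : ℝ)) atTop (𝓝 0))
    (h : ∀ t, Tendsto (fun n => altPGF ((μ n).map (X n)) (p n * t)) atTop
      (𝓝 (laplaceTransform (μ'.map W) (unitInterval.toNNReal ∘ t)))) :
    TendstoInDistribution (fun n => rescale (p n) ∘ X n) atTop W μ μ' := by
  have hrescale (n : ℕ) : Measurable (rescale (p n)) := measurable_of_countable _
  have (n : ℕ) : IsProbabilityMeasure ((μ n).map (X n)) := Measure.isProbabilityMeasure_map (hX n)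
  refine tendstoInDistribution_of_tendsto_laplaceTransform
    (fun n => (hrescale n).comp_aemeasurable (hX n)) hW ?_
  filter_upwards [eventually_nhds_zero_mem_range_toNNReal_comp]
  rintro _ ⟨t, rfl⟩
  simpa only [AEMeasurable.map_map_of_aemeasurable (hrescale _).aemeasurable (hX _)] using
    tendsto_laplaceTransform_map_rescale hp (h t)

end Rescaling

section Thinning

variable {Ω : Type*} [MeasurableSpace Ω] {s : ℕ} {μ : Measure Ω}
  {p : Fin s → I} {X : Ω → Fin s → ℕ} {ε : Fin s → ℕ → Ω → ℕ}

lemma integral_one_sub_pow_binomial_one (p : I) (t : ℝ) :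
    ∫ k, (1 - t) ^ k ∂(binomial 1 p) = 1 - p * t := by
  rw [integral_binomial, show Finset.Iic 1 = {0, 1} from rfl, Finset.sum_pair zero_ne_one]
  simp only [smul_eq_mul, Nat.choose_zero_right, Nat.choose_self, Nat.cast_one, pow_zero, pow_one,
    tsub_zero, tsub_self]
  ring

lemma IsThinningFamily.integral_one_sub_pow (hε : IsThinningFamily μ p X ε) (t : ℝ) (r : Fin s)
    (i : ℕ) : ∫ ω, (1 - t) ^ ε r i ω ∂μ = 1 - p r * t := by
  rw [← integral_one_sub_pow_binomial_one]
  exact (hε.law r i).integral_comp (measurable_of_countable _).aestronglyMeasurable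

lemma IsThinningFamily.integral_altPGFKernel_sum (hε : IsThinningFamily μ p X ε) (t : Fin s → I)
    (k : Fin s → ℕ) :
    ∫ ω, altPGFKernel t (fun r => ∑ i ∈ Finset.range (k r), ε r i ω) ∂μ =
      altPGFKernel (p * t) k := by
  let g : (Σ r : Fin s, Fin (k r)) → Fin s × ℕ := fun j => (j.1, j.2)
  have hg : g.Injective := by
    rintro ⟨r, i⟩ ⟨r', i'⟩ h
    simp only [g, Prod.mk.injEq] at h
    obtain ⟨rfl, h⟩ := h
    rw [Fin.ext h]
  calc ∫ ω, altPGFKernel t (fun r => ∑ i ∈ Finset.range (k r), ε r i ω) ∂μ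
      = ∫ ω, ∏ j, (1 - t (g j).1 : ℝ) ^ ε (g j).1 (g j).2 ω ∂μ := by
        simp only [altPGFKernel_apply, Fintype.prod_sigma, g, Finset.prod_pow_eq_pow_sum,
          Finset.sum_range]
    _ = ∏ j, ∫ ω, (1 - t (g j).1 : ℝ) ^ ε (g j).1 (g j).2 ω ∂μ :=
        (hε.indep_family.precomp hg).integral_fun_prod_comp
          (f := fun j (n : ℕ) => (1 - t (g j).1 : ℝ) ^ n) (fun j => (hε.law _ _).aemeasurable)
          (fun j => (measurable_of_countable _).aestronglyMeasurable)
    _ = altPGFKernel (p * t) k := by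
        simp [hε.integral_one_sub_pow, Fintype.prod_sigma, g]

lemma measurable_sum_range :
    Measurable fun x : (Fin s → ℕ) × (Fin s × ℕ → ℕ) =>
      fun r => ∑ i ∈ Finset.range (x.1 r), x.2 (r, i) :=
  measurable_from_prod_countable_right fun k => measurable_pi_lambda _ fun r => by
    dsimp only
    fun_prop

theorem IsThinningFamily.altPGF_map_thinned (hε : IsThinningFamily μ p X ε)
    (hX : AEMeasurable X μ) (t : Fin s → I) :
    altPGF (μ.map (thinned X ε)) t = altPGF (μ.map X) (p * t) := by
  set E : Ω → Fin s × ℕ → ℕ := fun ω j => ε j.1 j.2 ω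
  have hE : AEMeasurable E μ := aemeasurable_pi_lambda _ fun j => (hε.law j.1 j.2).aemeasurable
  set S : (Fin s → ℕ) × (Fin s × ℕ → ℕ) → Fin s → ℕ := fun x r =>
    ∑ i ∈ Finset.range (x.1 r), x.2 (r, i)
  have hS : Measurable S := measurable_sum_range
  have hG : StronglyMeasurable fun x => altPGFKernel t (S x) :=
    (altPGFKernel t).continuous.stronglyMeasurable.comp_measurable hS
  have := hε.indep_family.isProbabilityMeasure
  calc altPGF (μ.map (thinned X ε)) t
      = ∫ x, altPGFKernel t (S x) ∂(μ.map fun ω => (X ω, E ω)) := by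
        rw [← integral_map hS.aemeasurable (altPGFKernel t).continuous.aestronglyMeasurable,
          AEMeasurable.map_map_of_aemeasurable hS.aemeasurable (hX.prodMk hE)]
        rfl
    _ = ∫ k, ∫ e, altPGFKernel t (S (k, e)) ∂(μ.map E) ∂(μ.map X) := by
        rw [(indepFun_iff_map_prod_eq_prod_map_map hX hE).1 hε.indep_vector, integral_prod]
        exact .of_bound hG.aestronglyMeasurable _
          (.of_forall fun x => (altPGFKernel t).norm_coe_le_norm _)
    _ = ∫ k, altPGFKernel (p * t) k ∂(μ.map X) := by
        congr 1 with k
        rw [integral_map (f := fun e => altPGFKernel t (S (k, e))) hE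
          (hG.comp_measurable measurable_prodMk_left).aestronglyMeasurable]
        exact hε.integral_altPGFKernel_sum t k

end Thinning

section MixedPoisson

variable {Ω : Type*} [MeasurableSpace Ω] {s : ℕ} {ν : Measure Ω} [IsFiniteMeasure ν]
  {Z : Ω → Fin s → ℕ} {Ω' : Type*} [MeasurableSpace Ω'] {μ : Measure Ω'}
  [IsFiniteMeasure μ] {Y : Ω' → Fin s → ℝ}

theorem IsMixedPoisson.map_eq_comp (hZ : IsMixedPoisson ν Z (μ.map Y)) (hZm : AEMeasurable Z ν)
    (hY : AEMeasurable Y μ) (hY0 : ∀ᵐ ω ∂μ, ∀ r, 0 ≤ Y ω r) :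
    ν.map Z = poissonProductKernel ∘ₘ μ.map fun ω r => (Y ω r).toNNReal := by
  have hY' : AEMeasurable (fun ω r => (Y ω r).toNNReal) μ := by fun_prop
  have hQ : ∀ᵐ y ∂(μ.map Y), y ∈ {y : Fin s → ℝ | ∀ r, 0 ≤ y r} :=
    (ae_map_iff hY (by measurability)).2 hY0
  have hker (k : Fin s → ℕ) : Measurable fun y => poissonProductKernel y {k} :=
    poissonProductKernel.measurable_coe (measurableSet_singleton k)
  refine Measure.ext_of_singleton fun k => (measureReal_eq_measureReal_iff).1 ?_
  calc (ν.map Z).real {k} = ν.real {ω | Z ω = k} :=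
        map_measureReal_apply_of_aemeasurable hZm (measurableSet_singleton k)
    _ = ∫ ω, ∏ r, (Real.exp (-(Y ω r)) * Y ω r ^ k r / (Nat.factorial (k r) : ℝ)) ∂μ := by
        rw [hZ k, Measure.restrict_eq_self_of_ae_mem hQ, integral_map hY (by fun_prop)]
    _ = (∫⁻ ω, poissonProductKernel (fun r => (Y ω r).toNNReal) {k} ∂μ).toReal := by
        rw [← integral_toReal]
        · refine integral_congr_ae ?_
          filter_upwards [hY0] with ω hω
          rw [poissonProductKernel_apply_singleton, ENNReal.toReal_ofReal (by positivity)]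
          simp only [Real.coe_toNNReal _ (hω _)]
        · exact (hker k).comp_aemeasurable hY'
        · simp
    _ = (poissonProductKernel ∘ₘ μ.map fun ω r => (Y ω r).toNNReal).real {k} := by
        rw [Measure.real, Measure.bind_apply (measurableSet_singleton k)
          poissonProductKernel.aemeasurable, lintegral_map' (hker k).aemeasurable hY']

theorem IsMixedPoisson.altPGF_map (hZ : IsMixedPoisson ν Z (μ.map Y)) (hZm : AEMeasurable Z ν)
    (hY : AEMeasurable Y μ) (hY0 : ∀ᵐ ω ∂μ, ∀ r, 0 ≤ Y ω r) (t : Fin s → I) :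
    altPGF (ν.map Z) t =
      laplaceTransform (μ.map fun ω r => (Y ω r).toNNReal) (unitInterval.toNNReal ∘ t) := by
  rw [hZ.map_eq_comp hZm hY hY0, altPGF_comp_poissonProductKernel]

end MixedPoisson

theorem theorem5_general {s : ℕ}
    {Ω : ℕ → Type*} [∀ n, MeasurableSpace (Ω n)]
    (μ : ∀ n, Measure (Ω n)) [∀ n, IsProbabilityMeasure (μ n)]
    {Ω' : Type*} [MeasurableSpace Ω'] (μ' : Measure Ω') [IsProbabilityMeasure μ']
    {Ω'' : Type*} [MeasurableSpace Ω''] (μ'' : Measure Ω'') [IsProbabilityMeasure μ'']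
    (X : ∀ n, Ω n → Fin s → ℕ) (hX : ∀ n, AEMeasurable (X n) (μ n))
    (p : ℕ → Fin s → I) (hp : ∀ r, Tendsto (fun n => (p n r : ℝ)) atTop (𝓝 0))
    (ε : ∀ n, Fin s → ℕ → Ω n → ℕ) (hε : ∀ n, IsThinningFamily (μ n) (p n) (X n) (ε n))
    (Y : Ω' → Fin s → ℝ) (hY : AEMeasurable Y μ') (hY0 : ∀ᵐ ω ∂μ', ∀ r, 0 ≤ Y ω r)
    (Z : Ω'' → Fin s → ℕ) (hZ : IsMixedPoisson μ'' Z (μ'.map Y))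
    (hconv : TendstoInDistribution (fun n => thinned (X n) (ε n)) atTop Z μ μ'') :
    TendstoInDistribution (fun n ω r => (p n r : ℝ) * (X n ω r : ℝ)) atTop Y μ μ' := by
  have hpos : TendstoInDistribution (fun n => rescale (p n) ∘ X n) atTop
      (fun ω r => (Y ω r).toNNReal) μ μ' := by
    refine tendstoInDistribution_rescale_of_tendsto_altPGF hX (by fun_prop) hp fun t => ?_
    rw [← hZ.altPGF_map hconv.aemeasurable_limit hY hY0]
    simp only [← (hε _).altPGF_map_thinned (hX _)]
    exact ProbabilityMeasure.tendsto_iff_forall_integral_tendsto.1 hconv.tendsto (altPGFKernel t)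
  have hcoe : Continuous fun (y : Fin s → ℝ≥0) r => (y r : ℝ) := by fun_prop
  refine (hpos.continuous_comp hcoe).congr (fun n => .of_forall fun ω => ?_) ?_
  · ext r
    simp [rescale]
  · filter_upwards [hY0] with ω hω
    ext r
    simp [hω r]

theorem theorem5 {s : ℕ}
    {Ω : ℕ → Type*} [∀ n, MeasurableSpace (Ω n)]
    (μ : ∀ n, Measure (Ω n)) [∀ n, IsProbabilityMeasure (μ n)]
    {Ω' : Type*} [MeasurableSpace Ω'] (μ' : Measure Ω') [IsProbabilityMeasure μ']
    {Ω'' : Type*} [MeasurableSpace Ω''] (μ'' : Measure Ω'') [IsProbabilityMeasure μ'']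
    (X : ∀ n, Ω n → Fin s → ℕ) (hX : ∀ n, AEMeasurable (X n) (μ n))
    (p : ℕ → Fin s → I) (hp : ∀ r, Tendsto (fun n => (p n r : ℝ)) atTop (𝓝 0))
    (ε : ∀ n, Fin s → ℕ → Ω n → ℕ) (hε : ∀ n, IsThinningFamily (μ n) (p n) (X n) (ε n))
    (Y : Ω' → Fin s → ℝ) (hY : AEMeasurable Y μ') (hY0 : ∀ᵐ ω ∂μ', ∀ r, 0 ≤ Y ω r)
    (Z : Ω'' → Fin s → ℕ) (hZ : IsMixedPoisson μ'' Z (μ'.map Y))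
    (hconv : TendstoInDistribution (fun n => thinned (X n) (ε n)) atTop Z μ μ'')
    (hE : ∀ r, (⨆ n, ENNReal.ofReal (p n r) * ∫⁻ ω, (X n ω r : ENNReal) ∂(μ n)) < ⊤) :
    TendstoInDistribution (fun n ω r => (p n r : ℝ) * (X n ω r : ℝ)) atTop Y μ μ' :=
  theorem5_general μ μ' μ'' X hX p hp ε hε Y hY hY0 Z hZ hconv
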